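/- A symmetric probability measure $\mu$ on $\mathbb{R}$ with finite moments of all orders is said to have Jacobi sequence $\{\omega_n\}_{n\ge 1}$, $\omega_n>0$, if its monic orthogonal polynomials $P_0,P_1,\dots$ ($\deg P_n=n$) satisfy $xP_n(x)=P_{n+1}(x)+\omega_nP_{n-1}(x)$ for all $n\ge 0$, where $P_{-1}=0$. It is uniquely determined by its moments if every probability measure $\nu$ on $\mathbb{R}$ with finite moments $\int x^n\,d\nu=\int x^n\,d\mu$ for all $n\ge 0$ equals $\mu$. \textbf{Theorem.} Let $p>0$ be a real number. There is a symmetric probability measure on $\mathbb{R}$ with Jacobi sequence $\{n^p\}_{n\ge 1}$. Every such measure is uniquely determined by its moments if $p\le 2$, and none is if $p>2$. Moreover, there is exactly one symmetric probability measure with Jacobi sequence $\{n^p\}_{n\ge1}$ if and only if $p\le 2$. For $p=2$ this measure is the hyperbolic secant distribution $\dfrac{dx}{e^{\pi x/2}+e^{-\pi x/2}}$: it is a symmetric probability measure with Jacobi sequence $\{n^2\}_{n\ge1}$, and it is uniquely determined by its moments. -/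

import Mathlib

open MeasureTheory Polynomial

/-- All moments of the measure `μ` on the real line are finite. -/
def FiniteMoments (μ : Measure ℝ) : Prop :=
  ∀ n : ℕ, Integrable (fun x : ℝ => x ^ n) μ

/-- `P` is the sequence of monic orthogonal polynomials of `μ`: `P n` is monic of degree `n`, and
different members are orthogonal in `L²(μ)`. -/
structure IsMonicOrthogonal (μ : Measure ℝ) (P : ℕ → ℝ[X]) : Prop where
  monic : ∀ n, (P n).Monic
  natDegree_eq : ∀ n, (P n).natDegree = n
  orthogonal : ∀ m n, m ≠ n → ∫ x, (P m).eval x * (P n).eval x ∂μ = 0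

/-- `α` and `ω` (both indexed from `1`; the values at `0` are not used) are the Jacobi sequences
of `μ`: the monic orthogonal polynomials of `μ` satisfy
`x P_n = P_{n+1} + α_{n+1} P_n + ω_n P_{n-1}` for all `n ≥ 0`, with `P_{-1} = 0`. -/
def HasJacobiSequences (μ : Measure ℝ) (α ω : ℕ → ℝ) : Prop :=
  FiniteMoments μ ∧
  ∃ P : ℕ → ℝ[X], IsMonicOrthogonal μ P ∧
    X * P 0 = P 1 + C (α 1) * P 0 ∧
    ∀ n : ℕ, X * P (n + 1) = P (n + 2) + C (α (n + 2)) * P (n + 1) + C (ω (n + 1)) * P n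

/-- `μ` is a symmetric probability measure on the real line with Jacobi sequence
`ω 1, ω 2, …` (the other Jacobi sequence `α` of a symmetric measure is zero). -/
structure IsSymmetricWithJacobi (μ : Measure ℝ) (ω : ℕ → ℝ) : Prop where
  isProbabilityMeasure : IsProbabilityMeasure μ
  isNegInvariant : μ.IsNegInvariant
  hasJacobiSequences : HasJacobiSequences μ (fun _ => 0) ω

/-- The probability measure `μ` is uniquely determined by its moments, among all probability
measures on the real line whose moments are finite. -/
def IsMomentDeterminate (μ : Measure ℝ) : Prop :=
  ∀ ν : Measure ℝ, IsProbabilityMeasure ν → FiniteMoments ν →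
    (∀ n : ℕ, ∫ x, x ^ n ∂ν = ∫ x, x ^ n ∂μ) → ν = μ

/-- The hyperbolic secant distribution `dx / (e^{πx/2} + e^{-πx/2})`. -/
noncomputable def hyperbolicSecant : Measure ℝ :=
  volume.withDensity fun x : ℝ =>
    ENNReal.ofReal (1 / (Real.exp (Real.pi * x / 2) + Real.exp (-(Real.pi * x / 2))))

/-!
The `n`-th moment of a symmetric probability measure with Jacobi sequence `ω` is a weighted count
of Dyck paths of length `n`, a step down from height `k` having weight `ω k`. If `ω n = O(n ^ 2)`,
this bounds the moments by `n! * C ^ n`, so the moment generating function is finite near `0` and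
the measure is determinate.

Existence holds for every nonnegative `ω`: the spectral measures at `e₀` of the truncated Jacobi
matrices have the right moments up to an order growing with the truncation, and one takes a weak
limit. If `ω` is log-concave and `∑ 1 / √(ω n)` converges (Berezanskii's condition), the equations
`J v = e₀` and `J v = 0` for the infinite Jacobi matrix `J` have square-summable solutions,
supported on odd and on even indices respectively. The first keeps the spectral mass near `0` small
along truncations of one parity, the second keeps an atom at `0` along the other, and so the weak
limits along the two subsequences are different measures.

The hyperbolic secant distribution has moment generating function `1 / cos`, and the functions
`k! * tan ^ k / cos` satisfy the recursion of the Dyck path counts with `ω k = k ^ 2`.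
-/

section JacobiPolynomials

variable {R : Type*} [CommRing R] (ω : ℕ → R)

/-- The monic polynomials determined by the three-term recurrence `X P_n = P_{n+1} + ω_n P_{n-1}`.
As in `HasJacobiSequences`, the value `ω 0` is not used. -/
noncomputable def jacobiPoly : ℕ → R[X]
  | 0 => 1
  | 1 => X
  | n + 2 => X * jacobiPoly (n + 1) - C (ω (n + 1)) * jacobiPoly n

theorem isMonicOfDegree_jacobiPoly [Nontrivial R] : ∀ n, IsMonicOfDegree (jacobiPoly ω n) n
  | 0 => isMonicOfDegree_zero_iff.2 rfl
  | 1 => isMonicOfDegree_X R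
  | n + 2 => by
    have hX : IsMonicOfDegree (X * jacobiPoly ω (n + 1)) (n + 2) := by
      rw [mul_comm]
      exact (isMonicOfDegree_jacobiPoly (n + 1)).mul (isMonicOfDegree_X R)
    refine hX.sub ((natDegree_C_mul_le _ _).trans_lt ?_)
    rw [(isMonicOfDegree_jacobiPoly n).natDegree_eq]
    omega

theorem X_mul_jacobiPoly (n : ℕ) :
    X * jacobiPoly ω (n + 1) = jacobiPoly ω (n + 2) + C (ω (n + 1)) * jacobiPoly ω n := by
  rw [jacobiPoly, sub_add_cancel]

theorem eq_jacobiPoly_of_recurrence {ω : ℕ → R} {P : ℕ → R[X]} (h0 : P 0 = 1) (h1 : P 1 = X)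
    (hP : ∀ n, X * P (n + 1) = P (n + 2) + C (ω (n + 1)) * P n) : ∀ n, P n = jacobiPoly ω n
  | 0 => h0
  | 1 => h1
  | n + 2 => by
    rw [jacobiPoly, ← eq_jacobiPoly_of_recurrence h0 h1 hP (n + 1),
      ← eq_jacobiPoly_of_recurrence h0 h1 hP n, hP, add_sub_cancel_right]

/-- The mixed moments `∫ x ^ n P_k` of a measure with Jacobi sequence `ω`. Combinatorially, this is
the sum over the nonnegative lattice paths of `n` steps `± 1` from height `k` to height `0`, where a
step down from height `j` has weight `ω j` and a step up has weight `1`. -/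
def jacobiMoment : ℕ → ℕ → R
  | 0, 0 => 1
  | 0, _ + 1 => 0
  | n + 1, 0 => jacobiMoment n 1
  | n + 1, k + 1 => jacobiMoment n (k + 2) + ω (k + 1) * jacobiMoment n k

theorem jacobiMoment_eq_zero_of_odd : ∀ n k, Odd (n + k) → jacobiMoment ω n k = 0
  | 0, 0, h => by simp at h
  | 0, _ + 1, _ => rfl
  | n + 1, 0, h => jacobiMoment_eq_zero_of_odd n 1 h
  | n + 1, k + 1, h => by
    rw [jacobiMoment, jacobiMoment_eq_zero_of_odd n (k + 2) (by grind),
      jacobiMoment_eq_zero_of_odd n k (by grind), mul_zero, add_zero]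

theorem jacobiMoment_eq_zero_of_lt : ∀ n k, n < k → jacobiMoment ω n k = 0
  | 0, _ + 1, _ => rfl
  | n + 1, k + 1, h => by
    rw [jacobiMoment, jacobiMoment_eq_zero_of_lt n (k + 2) (by omega),
      jacobiMoment_eq_zero_of_lt n k (by omega), mul_zero, add_zero]

variable {ω} {L : R[X] →ₗ[R] R}

theorem map_X_pow_succ_mul_jacobiPoly_succ (n k : ℕ) :
    L (X ^ (n + 1) * jacobiPoly ω (k + 1)) =
      L (X ^ n * jacobiPoly ω (k + 2)) + ω (k + 1) * L (X ^ n * jacobiPoly ω k) := by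
  rw [pow_succ, mul_assoc, X_mul_jacobiPoly, mul_add, map_add, mul_left_comm, ← smul_eq_C_mul,
    map_smul, smul_eq_mul]

theorem map_X_pow_mul_jacobiPoly_of_map_jacobiPoly (h1 : L 1 = 1)
    (hL : ∀ n, L (jacobiPoly ω (n + 1)) = 0) :
    ∀ n k, L (X ^ n * jacobiPoly ω k) = jacobiMoment ω n k
  | 0, 0 => by simp [jacobiPoly, jacobiMoment, h1]
  | 0, k + 1 => by simp [jacobiMoment, hL]
  | n + 1, 0 => by
    rw [jacobiMoment, ← map_X_pow_mul_jacobiPoly_of_map_jacobiPoly h1 hL n 1, jacobiPoly, mul_one,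
      jacobiPoly, pow_succ]
  | n + 1, k + 1 => by
    rw [map_X_pow_succ_mul_jacobiPoly_succ, jacobiMoment,
      map_X_pow_mul_jacobiPoly_of_map_jacobiPoly h1 hL n (k + 2),
      map_X_pow_mul_jacobiPoly_of_map_jacobiPoly h1 hL n k]

theorem map_X_pow_mul_jacobiPoly_of_map_X_pow (hL : ∀ n, L (X ^ n) = jacobiMoment ω n 0) (n : ℕ) :
    ∀ k, L (X ^ n * jacobiPoly ω k) = jacobiMoment ω n k
  | 0 => by rw [jacobiPoly, mul_one, hL]
  | 1 => by rw [jacobiPoly, ← pow_succ, hL, jacobiMoment]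
  | k + 2 => by
    have hrec := map_X_pow_succ_mul_jacobiPoly_succ (ω := ω) (L := L) n k
    rw [map_X_pow_mul_jacobiPoly_of_map_X_pow hL (n + 1) (k + 1),
      map_X_pow_mul_jacobiPoly_of_map_X_pow hL n k, jacobiMoment] at hrec
    exact (add_right_cancel hrec).symm

theorem map_mul_jacobiPoly_eq_zero (hL : ∀ n, L (X ^ n) = jacobiMoment ω n 0) {q : R[X]} {k : ℕ}
    (hq : q.natDegree < k) : L (q * jacobiPoly ω k) = 0 := by
  rw [q.as_sum_range_C_mul_X_pow, Finset.sum_mul, map_sum]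
  refine Finset.sum_eq_zero fun i hi => ?_
  rw [mul_assoc, ← smul_eq_C_mul, map_smul, map_X_pow_mul_jacobiPoly_of_map_X_pow hL,
    jacobiMoment_eq_zero_of_lt ω i k (by grind), smul_zero]

end JacobiPolynomials

section Moments

variable {μ : Measure ℝ}

theorem FiniteMoments.integrable_eval (h : FiniteMoments μ) (q : ℝ[X]) :
    Integrable (fun x => q.eval x) μ := by
  simp_rw [eval_eq_sum_range]
  exact integrable_finsetSum _ fun i _ => (h i).const_mul _

/-- Integration of polynomials against a measure with finite moments, as a linear functional. -/
noncomputable def FiniteMoments.momentFunctional (h : FiniteMoments μ) : ℝ[X] →ₗ[ℝ] ℝ where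
  toFun q := ∫ x, q.eval x ∂μ
  map_add' q r := by
    simp_rw [eval_add]
    exact integral_add (h.integrable_eval q) (h.integrable_eval r)
  map_smul' c q := by
    simp_rw [eval_smul]
    exact integral_smul c _

theorem FiniteMoments.momentFunctional_apply (h : FiniteMoments μ) (q : ℝ[X]) :
    h.momentFunctional q = ∫ x, q.eval x ∂μ :=
  rfl

theorem FiniteMoments.momentFunctional_X_pow (h : FiniteMoments μ) (n : ℕ) :
    h.momentFunctional (X ^ n) = ∫ x, x ^ n ∂μ := by
  simp only [h.momentFunctional_apply, eval_pow, eval_X]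

variable {ω : ℕ → ℝ}

theorem HasJacobiSequences.integral_pow [IsProbabilityMeasure μ]
    (h : HasJacobiSequences μ (fun _ => 0) ω) (n : ℕ) : ∫ x, x ^ n ∂μ = jacobiMoment ω n 0 := by
  obtain ⟨hfin, P, hP, hrec0, hrec⟩ := h
  have hP0 : P 0 = 1 := (hP.monic 0).natDegree_eq_zero.1 (hP.natDegree_eq 0)
  have hP1 : P 1 = X := by simpa [hP0] using hrec0.symm
  obtain rfl : P = jacobiPoly ω :=
    funext (eq_jacobiPoly_of_recurrence hP0 hP1 fun n => by simpa using hrec n)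
  have horth (k : ℕ) : hfin.momentFunctional (jacobiPoly ω (k + 1)) = 0 := by
    simpa [hP0, hfin.momentFunctional_apply] using hP.orthogonal 0 (k + 1) k.succ_ne_zero.symm
  simpa [jacobiPoly, hfin.momentFunctional_apply] using map_X_pow_mul_jacobiPoly_of_map_jacobiPoly
    (by simp [hfin.momentFunctional_apply]) horth n 0

theorem hasJacobiSequences_of_integral_pow (hfin : FiniteMoments μ)
    (h : ∀ n, ∫ x, x ^ n ∂μ = jacobiMoment ω n 0) : HasJacobiSequences μ (fun _ => 0) ω := by
  have horth (m n : ℕ) (hmn : m < n) :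
      ∫ x, (jacobiPoly ω m).eval x * (jacobiPoly ω n).eval x ∂μ = 0 := by
    have := map_mul_jacobiPoly_eq_zero (fun k => (hfin.momentFunctional_X_pow k).trans (h k))
      (((isMonicOfDegree_jacobiPoly ω m).natDegree_eq).trans_lt hmn)
    simpa only [hfin.momentFunctional_apply, eval_mul] using this
  refine ⟨hfin, jacobiPoly ω, ⟨fun n => (isMonicOfDegree_jacobiPoly ω n).monic,
    fun n => (isMonicOfDegree_jacobiPoly ω n).natDegree_eq, fun m n hmn => ?_⟩, ?_, fun n => ?_⟩
  · rcases hmn.lt_or_gt with hlt | hlt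
    · exact horth m n hlt
    · simpa only [mul_comm] using horth n m hlt
  · simp [jacobiPoly]
  · simp [X_mul_jacobiPoly]

theorem IsSymmetricWithJacobi.finiteMoments (h : IsSymmetricWithJacobi μ ω) :
    FiniteMoments μ :=
  h.hasJacobiSequences.1

theorem IsSymmetricWithJacobi.integral_pow (h : IsSymmetricWithJacobi μ ω) (n : ℕ) :
    ∫ x, x ^ n ∂μ = jacobiMoment ω n 0 :=
  have := h.isProbabilityMeasure
  h.hasJacobiSequences.integral_pow n

theorem IsSymmetricWithJacobi.existsUnique (hμ : IsSymmetricWithJacobi μ ω)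
    (h : IsMomentDeterminate μ) : ∃! ν, IsSymmetricWithJacobi ν ω :=
  ⟨μ, hμ, fun ν hν => h ν hν.isProbabilityMeasure hν.finiteMoments fun n => by
    rw [hν.integral_pow, hμ.integral_pow]⟩

end Moments

section Determinacy

open ProbabilityTheory Filter Set
open scoped Topology Nat

theorem jacobiMoment_nonneg {ω : ℕ → ℝ} (hω : ∀ k, 0 ≤ ω (k + 1)) :
    ∀ n k, 0 ≤ jacobiMoment ω n k
  | 0, 0 => zero_le_one
  | 0, _ + 1 => le_rfl
  | n + 1, 0 => jacobiMoment_nonneg hω n 1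
  | n + 1, k + 1 =>
    add_nonneg (jacobiMoment_nonneg hω n (k + 2)) (mul_nonneg (hω k) (jacobiMoment_nonneg hω n k))

theorem jacobiMoment_le {ω : ℕ → ℝ} {c : ℝ} (hc : 0 ≤ c) (hω : ∀ k, 0 ≤ ω (k + 1))
    (hωc : ∀ k : ℕ, ω (k + 1) ≤ (c * (k + 1)) ^ 2) :
    ∀ n k, jacobiMoment ω n k ≤ 2 ^ n * (c ^ (n + k) * (n + k)!)
  | 0, 0 => by simp [jacobiMoment]
  | 0, k + 1 => by
    rw [jacobiMoment]
    positivity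
  | n + 1, 0 => by
    calc jacobiMoment ω n 1 ≤ 2 ^ n * (c ^ (n + 1) * (n + 1)!) := jacobiMoment_le hc hω hωc n 1
      _ ≤ 2 ^ (n + 1) * (c ^ (n + 1) * (n + 1)!) := by gcongr <;> norm_num
  | n + 1, k + 1 => by
    have hup := jacobiMoment_le hc hω hωc n (k + 2)
    have hdown : ω (k + 1) * jacobiMoment ω n k ≤
        2 ^ n * (c ^ (n + (k + 2)) * (n + (k + 2))!) := by
      have hfac : ((n + (k + 2))! : ℝ) = (n + k + 2) * ((n + k + 1) * (n + k)!) := by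
        rw [← add_assoc, Nat.factorial_succ, Nat.factorial_succ]
        push_cast
        ring
      calc ω (k + 1) * jacobiMoment ω n k
          ≤ (c * (k + 1)) ^ 2 * (2 ^ n * (c ^ (n + k) * (n + k)!)) :=
            mul_le_mul (hωc k) (jacobiMoment_le hc hω hωc n k) (jacobiMoment_nonneg hω n k)
              (sq_nonneg _)
        _ = 2 ^ n * c ^ (n + (k + 2)) * ((k + 1) * ((k + 1) * (n + k)!)) := by ring
        _ ≤ 2 ^ n * c ^ (n + (k + 2)) * ((n + k + 2) * ((n + k + 1) * (n + k)!)) := by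
            gcongr <;> linarith [n.cast_nonneg (α := ℝ)]
        _ = 2 ^ n * (c ^ (n + (k + 2)) * (n + (k + 2))!) := by rw [hfac, mul_assoc]
    rw [jacobiMoment, show n + 1 + (k + 1) = n + (k + 2) by ring, pow_succ]
    linarith

variable {Ω Ω' : Type*} {_ : MeasurableSpace Ω} {_ : MeasurableSpace Ω'} {μ : Measure Ω}
  {ν : Measure Ω'} {Y : Ω → ℝ} {Z : Ω' → ℝ}

theorem integrable_of_hasSum_of_nonneg {ι : Type*} [Countable ι] {f : ι → Ω → ℝ} {g : Ω → ℝ}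
    (hf : ∀ i, Integrable (f i) μ) (hf0 : ∀ i x, 0 ≤ f i x) (hg : ∀ x, HasSum (f · x) (g x))
    (hsum : Summable fun i => ∫ x, f i x ∂μ) : Integrable g μ := by
  have hg0 (x : Ω) : 0 ≤ g x := (hg x).nonneg (hf0 · x)
  refine ⟨aestronglyMeasurable_of_tendsto_ae atTop
    (fun s => (integrable_finsetSum s fun i _ => hf i).aestronglyMeasurable)
    (ae_of_all _ fun x => hg x), ?_⟩
  rw [hasFiniteIntegral_iff_ofReal (ae_of_all _ hg0)]
  calc ∫⁻ x, ENNReal.ofReal (g x) ∂μ = ∫⁻ x, ∑' i, ENNReal.ofReal (f i x) ∂μ := by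
        refine lintegral_congr fun x => ?_
        rw [← (hg x).tsum_eq, ENNReal.ofReal_tsum_of_nonneg (hf0 · x) (hg x).summable]
    _ = ∑' i, ENNReal.ofReal (∫ x, f i x ∂μ) := by
        rw [lintegral_tsum fun i => (hf i).aemeasurable.ennreal_ofReal]
        simp only [ofReal_integral_eq_lintegral_ofReal (hf _) (ae_of_all _ (hf0 _))]
    _ = ENNReal.ofReal (∑' i, ∫ x, f i x ∂μ) :=
        (ENNReal.ofReal_tsum_of_nonneg (fun i => integral_nonneg (hf0 i)) hsum).symm
    _ < ⊤ := ENNReal.ofReal_lt_top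

theorem integrable_cosh_of_integral_pow_le {r t : ℝ} (hY : ∀ n, Integrable (fun x => Y x ^ n) μ)
    (h : ∀ n, ∫ x, Y x ^ (2 * n) ∂μ ≤ r ^ (2 * n) * (2 * n)!) (ht : |t * r| < 1) :
    Integrable (fun x => Real.cosh (t * Y x)) μ := by
  have hterm (n : ℕ) : Integrable (fun x => (t * Y x) ^ (2 * n) / (2 * n)!) μ := by
    simpa only [mul_pow] using ((hY (2 * n)).const_mul _).div_const _
  have hterm0 (n : ℕ) (x : Ω) : 0 ≤ (t * Y x) ^ (2 * n) / (2 * n)! :=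
    div_nonneg ((even_two_mul n).pow_nonneg _) (Nat.cast_nonneg _)
  refine integrable_of_hasSum_of_nonneg hterm hterm0 (fun x => Real.hasSum_cosh _) ?_
  refine .of_nonneg_of_le (fun n => integral_nonneg (hterm0 n)) (fun n => ?_)
    (summable_geometric_of_lt_one (sq_nonneg (t * r)) ((sq_lt_one_iff_abs_lt_one _).2 ht))
  calc ∫ x, (t * Y x) ^ (2 * n) / (2 * n)! ∂μ
      = t ^ (2 * n) * (∫ x, Y x ^ (2 * n) ∂μ) / (2 * n)! := by
        simp_rw [mul_pow, integral_div, integral_const_mul]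
    _ ≤ t ^ (2 * n) * (r ^ (2 * n) * (2 * n)!) / (2 * n)! := by
        gcongr
        · exact (even_two_mul n).pow_nonneg _
        · exact h n
    _ = ((t * r) ^ 2) ^ n := by
        field_simp
        ring

theorem zero_mem_interior_integrableExpSet_of_integral_pow_le {r : ℝ}
    (hY : ∀ n, Integrable (fun x => Y x ^ n) μ)
    (h : ∀ n, ∫ x, Y x ^ (2 * n) ∂μ ≤ r ^ (2 * n) * (2 * n)!) :
    0 ∈ interior (integrableExpSet Y μ) := by
  have hnhds : ∀ᶠ t in 𝓝 (0 : ℝ), |t * r| < 1 := by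
    have hcont : Continuous fun t : ℝ => |t * r| := by fun_prop
    exact hcont.continuousAt.eventually_lt continuousAt_const (by simp)
  refine mem_interior_iff_mem_nhds.2 (hnhds.mono fun t ht => ?_)
  have hmeas : AEStronglyMeasurable Y μ := by simpa using (hY 1).aestronglyMeasurable
  refine ((integrable_cosh_of_integral_pow_le hY h ht).const_mul 2).mono'
    (Real.continuous_exp.comp_aestronglyMeasurable (hmeas.const_mul t)) (ae_of_all _ fun x => ?_)
  rw [Real.norm_of_nonneg (Real.exp_pos _).le, Real.cosh_eq]
  linarith [Real.exp_pos (-(t * Y x))]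

theorem mgf_eventuallyEq_of_integral_pow_eq (hY : 0 ∈ interior (integrableExpSet Y μ))
    (hZ : 0 ∈ interior (integrableExpSet Z ν))
    (h : ∀ n, ∫ x, Y x ^ n ∂μ = ∫ x, Z x ^ n ∂ν) : mgf Y μ =ᶠ[𝓝 0] mgf Z ν := by
  have hYseries := hasFPowerSeriesAt_mgf hY
  have hZseries := hasFPowerSeriesAt_mgf hZ
  simp only [zero_mul, Real.exp_zero, mul_one, h] at hYseries hZseries
  filter_upwards [hYseries.eventually_hasSum, hZseries.eventually_hasSum] with t hYt hZt
  simpa using hYt.unique hZt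

theorem eqOn_complexMGF_of_mgf_eventuallyEq {v : ℝ} (hY : v ∈ interior (integrableExpSet Y μ))
    (hZ : v ∈ interior (integrableExpSet Z ν)) (h : mgf Y μ =ᶠ[𝓝 v] mgf Z ν) :
    EqOn (complexMGF Y μ) (complexMGF Z ν)
      {z | z.re ∈ interior (integrableExpSet Y μ) ∩ interior (integrableExpSet Z ν)} := by
  have hconn : IsPreconnected
      {z : ℂ | z.re ∈ interior (integrableExpSet Y μ) ∩ interior (integrableExpSet Z ν)} :=
    ((convex_integrableExpSet.interior.inter convex_integrableExpSet.interior).linear_preimage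
      Complex.reLm).isPreconnected
  refine AnalyticOnNhd.eqOn_of_preconnected_of_frequently_eq
    (analyticOnNhd_complexMGF.mono fun z hz => hz.1)
    (analyticOnNhd_complexMGF.mono fun z hz => hz.2) hconn (z₀ := (v : ℂ)) ⟨hY, hZ⟩ ?_
  have hreal : ∃ᶠ t : ℝ in 𝓝[≠] v, complexMGF Y μ t = complexMGF Z ν t := by
    refine Eventually.frequently ((h.filter_mono nhdsWithin_le_nhds).mono fun t ht => ?_)
    rw [complexMGF_ofReal, complexMGF_ofReal, ht]
  exact (Complex.continuous_ofReal.continuousAt.tendsto.inf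
    (tendsto_principal_principal.2 fun t ht => by simpa using ht)).frequently hreal

theorem map_eq_map_of_integral_pow_eq [IsFiniteMeasure μ] [IsFiniteMeasure ν]
    (hY : 0 ∈ interior (integrableExpSet Y μ)) (hZ : 0 ∈ interior (integrableExpSet Z ν))
    (h : ∀ n, ∫ x, Y x ^ n ∂μ = ∫ x, Z x ^ n ∂ν) : μ.map Y = ν.map Z := by
  refine Measure.ext_of_charFun (funext fun t => ?_)
  rw [← complexMGF_mul_I (aemeasurable_of_mem_interior_integrableExpSet hY),
    ← complexMGF_mul_I (aemeasurable_of_mem_interior_integrableExpSet hZ)]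
  exact eqOn_complexMGF_of_mgf_eventuallyEq hY hZ (mgf_eventuallyEq_of_integral_pow_eq hY hZ h)
    (by simpa using ⟨hY, hZ⟩)

theorem isMomentDeterminate_of_integral_pow_le {μ : Measure ℝ} [IsFiniteMeasure μ]
    (hfin : FiniteMoments μ) {r : ℝ} (h : ∀ n, ∫ x, x ^ (2 * n) ∂μ ≤ r ^ (2 * n) * (2 * n)!) :
    IsMomentDeterminate μ := fun ν _ hν heq => by
  simpa using map_eq_map_of_integral_pow_eq (Y := id) (Z := id)
    (zero_mem_interior_integrableExpSet_of_integral_pow_le hν fun n => (heq (2 * n)).trans_le (h n))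
    (zero_mem_interior_integrableExpSet_of_integral_pow_le hfin h) heq

theorem IsSymmetricWithJacobi.isMomentDeterminate {μ : Measure ℝ} {ω : ℕ → ℝ}
    (h : IsSymmetricWithJacobi μ ω) {c : ℝ} (hc : 0 ≤ c) (hω : ∀ k, 0 ≤ ω (k + 1))
    (hωc : ∀ k : ℕ, ω (k + 1) ≤ (c * (k + 1)) ^ 2) : IsMomentDeterminate μ := by
  have := h.isProbabilityMeasure
  refine isMomentDeterminate_of_integral_pow_le h.finiteMoments (r := 2 * c) fun n => ?_
  rw [h.integral_pow, mul_pow, mul_assoc]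
  exact jacobiMoment_le hc hω hωc (2 * n) 0

end Determinacy

section WeakConvergence

open Filter
open scoped Topology ENNReal

variable {Ω : Type*} [TopologicalSpace Ω] [MeasurableSpace Ω] [OpensMeasurableSpace Ω]
  [HasOuterApproxClosed Ω]

theorem integral_one_add_mul_sq {Ω : Type*} [MeasurableSpace Ω] {μ : Measure Ω}
    [IsProbabilityMeasure μ] {g : Ω → ℝ} (hg : MemLp g 2 μ) (c : ℝ) :
    ∫ x, (1 + c * g x) ^ 2 ∂μ = 1 + 2 * c * ∫ x, g x ∂μ + c ^ 2 * ∫ x, g x ^ 2 ∂μ := by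
  have hlin : Integrable (fun x => 1 + 2 * c * g x) μ :=
    (integrable_const 1).add ((hg.integrable one_le_two).const_mul _)
  calc ∫ x, (1 + c * g x) ^ 2 ∂μ = ∫ x, (1 + 2 * c * g x) + c ^ 2 * g x ^ 2 ∂μ := by
        congr with x
        ring
    _ = _ := by
        rw [integral_add hlin (hg.integrable_sq.const_mul _), integral_const_mul,
          integral_add (integrable_const 1) ((hg.integrable one_le_two).const_mul _),
          integral_const_mul, integral_const, probReal_univ, one_smul]

theorem measureReal_le_of_tendsto_of_isOpen {ι : Type*} {l : Filter ι} [l.NeBot]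
    {μ : ι → ProbabilityMeasure Ω} {ν : ProbabilityMeasure Ω} (hν : Tendsto μ l (𝓝 ν)) {G : Set Ω}
    (hG : IsOpen G) {a : ℝ} (h : ∀ i, (μ i : Measure Ω).real G ≤ a) :
    (ν : Measure Ω).real G ≤ a := by
  obtain ⟨i⟩ := l.nonempty_of_neBot
  refine ENNReal.toReal_le_of_le_ofReal (measureReal_nonneg.trans (h i)) ?_
  refine (ProbabilityMeasure.le_liminf_measure_open_of_tendsto hν hG).trans
    (liminf_le_of_frequently_le' (.of_forall fun j => ?_))
  exact ENNReal.le_ofReal_iff_toReal_le (measure_ne_top _ _)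
    (measureReal_nonneg.trans (h j)) |>.2 (h j)

theorem le_measureReal_of_tendsto_of_isClosed {ι : Type*} {l : Filter ι} [l.NeBot]
    {μ : ι → ProbabilityMeasure Ω} {ν : ProbabilityMeasure Ω} (hν : Tendsto μ l (𝓝 ν)) {F : Set Ω}
    (hF : IsClosed F) {a : ℝ} (h : ∀ i, a ≤ (μ i : Measure Ω).real F) :
    a ≤ (ν : Measure Ω).real F := by
  refine (ENNReal.ofReal_le_iff_le_toReal (measure_ne_top _ _)).1 ?_
  refine le_trans (le_limsup_of_frequently_le' (.of_forall fun i => ?_))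
    (ProbabilityMeasure.limsup_measure_closed_le_of_tendsto hν hF)
  exact (ENNReal.ofReal_le_iff_le_toReal (measure_ne_top _ _)).2 (h i)

variable {μ : ℕ → ProbabilityMeasure Ω} {ν : ProbabilityMeasure Ω}

theorem integrable_and_integral_le_of_tendsto (hν : Tendsto μ atTop (𝓝 ν)) {f : Ω → ℝ}
    (hf : Continuous f) (hf0 : 0 ≤ f) {C : ℝ}
    (h : ∀ᶠ n in atTop, Integrable f (μ n) ∧ ∫ x, f x ∂(μ n : Measure Ω) ≤ C) :
    Integrable f ν ∧ ∫ x, f x ∂(ν : Measure Ω) ≤ C := by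
  have hle : ∫⁻ x, ENNReal.ofReal (f x) ∂(ν : Measure Ω) ≤ ENNReal.ofReal C := by
    refine (lintegral_le_liminf_lintegral_of_forall_isOpen_measure_le_liminf_measure hf hf0
      fun G hG => ProbabilityMeasure.le_liminf_measure_open_of_tendsto hν hG).trans ?_
    refine liminf_le_of_frequently_le' (h.mono fun n hn => ?_).frequently
    rw [← ofReal_integral_eq_lintegral_ofReal hn.1 (ae_of_all _ hf0)]
    exact ENNReal.ofReal_le_ofReal hn.2
  have hfint : Integrable f ν := ⟨hf.aestronglyMeasurable,
    (hasFiniteIntegral_iff_ofReal (ae_of_all _ hf0)).2 (hle.trans_lt ENNReal.ofReal_lt_top)⟩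
  obtain ⟨n, -, hn⟩ := h.exists
  refine ⟨hfint, (ENNReal.ofReal_le_ofReal_iff ((integral_nonneg hf0).trans hn)).1 ?_⟩
  rwa [ofReal_integral_eq_lintegral_ofReal hfint (ae_of_all _ hf0)]

theorem integral_le_of_tendsto (hν : Tendsto μ atTop (𝓝 ν)) {g : Ω → ℝ} (hg : Continuous g)
    {a C : ℝ}
    (hsq : ∀ᶠ n in atTop,
      Integrable (fun x => g x ^ 2) (μ n) ∧ ∫ x, g x ^ 2 ∂(μ n : Measure Ω) ≤ C)
    (h : ∀ᶠ n in atTop, ∫ x, g x ∂(μ n : Measure Ω) ≤ a) :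
    ∫ x, g x ∂(ν : Measure Ω) ≤ a := by
  have hsqν := integrable_and_integral_le_of_tendsto hν (f := fun x => g x ^ 2) (hg.pow 2)
    (fun x => sq_nonneg _) hsq
  have hsqν0 : 0 ≤ ∫ x, g x ^ 2 ∂(ν : Measure Ω) := integral_nonneg fun x => sq_nonneg _
  have hmem {ρ : ProbabilityMeasure Ω} (hρ : Integrable (fun x => g x ^ 2) ρ) :
      MemLp g 2 (ρ : Measure Ω) :=
    (memLp_two_iff_integrable_sq hg.measurable.aestronglyMeasurable).2 hρ
  -- The integrand `(1 + ε g) ^ 2` is nonnegative, so Fatou applies to it although `g` has no sign.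
  have hfatou (ε : ℝ) (hε : 0 < ε) : ∫ x, g x ∂(ν : Measure Ω) ≤ a + ε * C := by
    have hle : ∫ x, (1 + ε * g x) ^ 2 ∂(ν : Measure Ω) ≤ 1 + 2 * ε * a + ε ^ 2 * C := by
      refine (integrable_and_integral_le_of_tendsto hν (f := fun x => (1 + ε * g x) ^ 2)
        (((hg.const_mul ε).const_add 1).pow 2) (fun x => sq_nonneg _) ?_).2
      filter_upwards [hsq, h] with n hn hna
      have hlin : MemLp (fun x => 1 + ε * g x) 2 (μ n : Measure Ω) :=
        (memLp_const (1 : ℝ)).add ((hmem hn.1).const_mul ε)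
      refine ⟨hlin.integrable_sq, ?_⟩
      rw [integral_one_add_mul_sq (hmem hn.1)]
      gcongr
      exact hn.2
    rw [integral_one_add_mul_sq (hmem hsqν.1)] at hle
    have hC : 0 ≤ C := hsqν0.trans hsqν.2
    nlinarith [mul_nonneg (sq_nonneg ε) hsqν0, mul_nonneg (sq_nonneg ε) hC]
  refine ge_of_tendsto' (f := fun n : ℕ => a + 1 / ((n : ℝ) + 1) * C) (x := atTop) ?_
    fun n => hfatou _ (by positivity)
  simpa using (tendsto_one_div_add_atTop_nhds_zero_nat.mul_const C).const_add a

theorem integral_eq_of_tendsto (hν : Tendsto μ atTop (𝓝 ν)) {g : Ω → ℝ} (hg : Continuous g)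
    {a C : ℝ}
    (hsq : ∀ᶠ n in atTop,
      Integrable (fun x => g x ^ 2) (μ n) ∧ ∫ x, g x ^ 2 ∂(μ n : Measure Ω) ≤ C)
    (h : ∀ᶠ n in atTop, ∫ x, g x ∂(μ n : Measure Ω) = a) :
    ∫ x, g x ∂(ν : Measure Ω) = a := by
  refine le_antisymm (integral_le_of_tendsto hν hg hsq (h.mono fun n hn => hn.le)) ?_
  have hneg := integral_le_of_tendsto hν (g := fun x => -g x) hg.neg (a := -a) (C := C)
    (by simpa only [neg_sq] using hsq) (h.mono fun n hn => by rw [integral_neg, hn])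
  rwa [integral_neg, neg_le_neg_iff] at hneg

end WeakConvergence

section HellySelection

open Filter
open scoped Topology ENNReal

theorem isTightMeasureSet_range_of_lintegral_enorm_pow_le {E : Type*} [NormedAddCommGroup E]
    [ProperSpace E] [MeasurableSpace E] [BorelSpace E] {μ : ℕ → Measure E}
    [∀ n, IsFiniteMeasure (μ n)] {k : ℕ} (hk : k ≠ 0) {C : ℝ≥0∞} (hC : C ≠ ∞)
    (h : ∀ᶠ n in atTop, ∫⁻ x, ‖x‖ₑ ^ k ∂μ n ≤ C) : IsTightMeasureSet (Set.range μ) := by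
  refine isTightMeasureSet_range_of_tendsto_limsup_measure_norm_gt ?_
  have hlim : Tendsto (fun r : ℝ => C / ENNReal.ofReal r ^ k) atTop (𝓝 0) := by
    have hpow := ((ENNReal.continuous_pow k).tendsto' ∞ ∞ (ENNReal.top_pow hk)).comp
      ENNReal.tendsto_ofReal_atTop
    simpa using ENNReal.Tendsto.const_div hpow (.inr hC)
  refine tendsto_of_tendsto_of_tendsto_of_le_of_le' tendsto_const_nhds hlim
    (.of_forall fun _ => zero_le) ?_
  filter_upwards [eventually_gt_atTop 0] with r hr
  refine limsup_le_of_le (by isBoundedDefault) (h.mono fun n hn => ?_)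
  calc μ n {x | r < ‖x‖} ≤ μ n {x | ENNReal.ofReal r ^ k ≤ ‖x‖ₑ ^ k} := by
        refine measure_mono fun x hx => ?_
        rw [Set.mem_ofPred_eq, ← ofReal_norm]
        gcongr
        exact le_of_lt hx
    _ ≤ (∫⁻ x, ‖x‖ₑ ^ k ∂μ n) / ENNReal.ofReal r ^ k :=
        meas_ge_le_lintegral_div (by fun_prop) (by positivity) (by finiteness)
    _ ≤ C / ENNReal.ofReal r ^ k := by gcongr

theorem FiniteMoments.of_integrable_even {μ : Measure ℝ} [IsFiniteMeasure μ]
    (h : ∀ n, Integrable (fun x : ℝ => x ^ (2 * n)) μ) : FiniteMoments μ := fun n =>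
  ((memLp_two_iff_integrable_sq (by fun_prop)).2
    (by simpa only [← pow_mul, mul_comm n] using h n)).integrable one_le_two

theorem exists_tendsto_subseq_of_moments {μ : ℕ → ProbabilityMeasure ℝ} {m : ℕ → ℝ}
    (hfin : ∀ N, FiniteMoments (μ N))
    (hm : ∀ k, ∀ᶠ N in atTop, ∫ x, x ^ k ∂(μ N : Measure ℝ) = m k) :
    ∃ (ν : ProbabilityMeasure ℝ) (φ : ℕ → ℕ), StrictMono φ ∧ Tendsto (μ ∘ φ) atTop (𝓝 ν) ∧
      FiniteMoments ν ∧ ∀ k, ∫ x, x ^ k ∂(ν : Measure ℝ) = m k := by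
  have htight : IsTightMeasureSet (Set.range fun N => (μ N : Measure ℝ)) := by
    refine isTightMeasureSet_range_of_lintegral_enorm_pow_le two_ne_zero
      (ENNReal.ofReal_ne_top (r := m 2)) ((hm 2).mono fun N hN => ?_)
    rw [← hN, ofReal_integral_eq_lintegral_ofReal (hfin N 2) (ae_of_all _ fun x => sq_nonneg x)]
    simp only [← enorm_pow, Real.enorm_of_nonneg (sq_nonneg _), le_refl]
  have hcompact : IsCompact (closure (Set.range μ)) :=
    isCompact_closure_of_isTightMeasureSet (by simpa [Set.range] using htight)
  obtain ⟨ν, -, φ, hφ, hν⟩ := hcompact.tendsto_subseq fun N => subset_closure (Set.mem_range_self N)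
  have hmφ (k : ℕ) : ∀ᶠ N in atTop, ∫ x, x ^ k ∂((μ ∘ φ) N : Measure ℝ) = m k :=
    hφ.tendsto_atTop.eventually (hm k)
  have hsq (k : ℕ) : ∀ᶠ N in atTop, Integrable (fun x : ℝ => (x ^ k) ^ 2) ((μ ∘ φ) N) ∧
      ∫ x, (x ^ k) ^ 2 ∂((μ ∘ φ) N : Measure ℝ) ≤ m (k * 2) :=
    (hmφ (k * 2)).mono fun N hN => by simpa only [← pow_mul] using ⟨hfin (φ N) _, hN.le⟩
  refine ⟨ν, φ, hφ, hν, .of_integrable_even fun k => ?_, fun k =>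
    integral_eq_of_tendsto hν (continuous_pow k) (hsq k) (hmφ k)⟩
  rw [mul_comm]
  simp only [pow_mul]
  exact (integrable_and_integral_le_of_tendsto hν ((continuous_pow k).pow 2) (fun x => sq_nonneg _)
    (hsq k)).1

end HellySelection

section SpectralMeasure

variable {V : Type*} [NormedAddCommGroup V] [InnerProductSpace ℝ V] [FiniteDimensional ℝ V]
  {T : V →ₗ[ℝ] V}

/-- The spectral measure of the symmetric operator `T` at the vector `e`: each eigenvalue is
weighted by the squared norm of the projection of `e` to its eigenspace. -/
noncomputable def spectralMeasure (hT : T.IsSymmetric) (e : V) : Measure ℝ :=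
  ∑ i, ENNReal.ofReal (inner ℝ (hT.eigenvectorBasis rfl i) e ^ 2) •
    Measure.dirac (hT.eigenvalues rfl i)

variable (hT : T.IsSymmetric) (e : V)

theorem integrable_spectralMeasure (f : ℝ → ℝ) : Integrable f (spectralMeasure hT e) :=
  integrable_finsetSum_measure.2 fun _ _ =>
    (integrable_dirac (by simp)).smul_measure ENNReal.ofReal_ne_top

theorem integral_spectralMeasure (f : ℝ → ℝ) :
    ∫ x, f x ∂(spectralMeasure hT e) =
      ∑ i, inner ℝ (hT.eigenvectorBasis rfl i) e ^ 2 * f (hT.eigenvalues rfl i) := by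
  rw [spectralMeasure, integral_finsetSum_measure fun i _ =>
    (integrable_dirac (by simp)).smul_measure ENNReal.ofReal_ne_top]
  refine Finset.sum_congr rfl fun i _ => ?_
  rw [integral_smul_measure, integral_dirac, ENNReal.toReal_ofReal (sq_nonneg _), smul_eq_mul]

theorem measureReal_spectralMeasure {s : Set ℝ} (hs : MeasurableSet s) :
    (spectralMeasure hT e).real s = ∑ i,
      inner ℝ (hT.eigenvectorBasis rfl i) e ^ 2 * s.indicator 1 (hT.eigenvalues rfl i) := by
  rw [← integral_indicator_one hs, integral_spectralMeasure]

theorem isProbabilityMeasure_spectralMeasure (he : ‖e‖ = 1) :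
    IsProbabilityMeasure (spectralMeasure hT e) := by
  rw [isProbabilityMeasure_iff_real, measureReal_spectralMeasure hT e .univ]
  simp [OrthonormalBasis.sum_sq_inner_right, he]

theorem inner_eigenvectorBasis_pow_apply (n : ℕ) (u : V) (i) :
    inner ℝ (hT.eigenvectorBasis rfl i) ((T ^ n) u) =
      hT.eigenvalues rfl i ^ n * inner ℝ (hT.eigenvectorBasis rfl i) u := by
  rw [← hT.pow n, (hT.hasEigenvector_eigenvectorBasis rfl i).pow_apply, real_inner_smul_left]
  rfl

theorem inner_eigenvectorBasis_apply (u : V) (i) :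
    inner ℝ (hT.eigenvectorBasis rfl i) (T u) =
      hT.eigenvalues rfl i * inner ℝ (hT.eigenvectorBasis rfl i) u := by
  simpa using inner_eigenvectorBasis_pow_apply hT 1 u i

theorem integral_pow_spectralMeasure (n : ℕ) :
    ∫ x, x ^ n ∂(spectralMeasure hT e) = inner ℝ e ((T ^ n) e) := by
  rw [integral_spectralMeasure, ← (hT.eigenvectorBasis rfl).sum_inner_mul_inner e]
  refine Finset.sum_congr rfl fun i _ => ?_
  rw [inner_eigenvectorBasis_pow_apply, real_inner_comm]
  ring

variable {hT e}

theorem measureReal_spectralMeasure_ball_le {c : ℝ} {u : V} (hu : T u = c • u + e) (ε : ℝ) :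
    (spectralMeasure hT e).real (Metric.ball c ε) ≤ ε ^ 2 * ‖u‖ ^ 2 := by
  rw [measureReal_spectralMeasure hT e Metric.isOpen_ball.measurableSet,
    ← (hT.eigenvectorBasis rfl).sum_sq_inner_right u, Finset.mul_sum]
  refine Finset.sum_le_sum fun i _ => ?_
  have he : inner ℝ (hT.eigenvectorBasis rfl i) e =
      (hT.eigenvalues rfl i - c) * inner ℝ (hT.eigenvectorBasis rfl i) u := by
    rw [eq_sub_of_add_eq' hu.symm, inner_sub_right, inner_eigenvectorBasis_apply,
      real_inner_smul_right]
    ring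
  by_cases h : hT.eigenvalues rfl i ∈ Metric.ball c ε
  · have hε : (hT.eigenvalues rfl i - c) ^ 2 ≤ ε ^ 2 := by
      rw [Metric.mem_ball, Real.dist_eq] at h
      exact sq_le_sq' (neg_le_of_abs_le h.le) (le_of_abs_le h.le)
    rw [Set.indicator_of_mem h, Pi.one_apply, mul_one, he, mul_pow]
    gcongr
  · rw [Set.indicator_of_notMem h, mul_zero]
    positivity

theorem sq_inner_le_measureReal_spectralMeasure_singleton {c : ℝ} {u : V} (hu : T u = c • u) :
    inner ℝ u e ^ 2 ≤ ‖u‖ ^ 2 * (spectralMeasure hT e).real {c} := by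
  have hc (i) (hi : hT.eigenvalues rfl i ≠ c) : inner ℝ (hT.eigenvectorBasis rfl i) u = 0 := by
    have h := inner_eigenvectorBasis_apply hT u i
    rw [hu, real_inner_smul_right] at h
    exact (mul_eq_mul_right_iff.1 h).resolve_left hi.symm
  have hsum : inner ℝ u e = ∑ i, inner ℝ (hT.eigenvectorBasis rfl i) u *
      (inner ℝ (hT.eigenvectorBasis rfl i) e *
        ({c} : Set ℝ).indicator 1 (hT.eigenvalues rfl i)) := by
    rw [← (hT.eigenvectorBasis rfl).sum_inner_mul_inner u e]
    refine Finset.sum_congr rfl fun i _ => ?_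
    rw [real_inner_comm]
    by_cases hi : hT.eigenvalues rfl i = c
    · simp [hi]
    · simp [hc i hi]
  rw [hsum, measureReal_spectralMeasure hT e (measurableSet_singleton c),
    ← (hT.eigenvectorBasis rfl).sum_sq_inner_right u]
  refine (Finset.sum_mul_sq_le_sq_mul_sq _ _ _).trans_eq ?_
  congr 1
  refine Finset.sum_congr rfl fun i _ => ?_
  by_cases hi : hT.eigenvalues rfl i = c <;> simp [hi]

end SpectralMeasure

section JacobiMatrices

/-- The `N × N` truncation of the Jacobi matrix with zero diagonal and off-diagonal entries
`√(ω 1), √(ω 2), …`. -/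
noncomputable def jacobiMatrix (ω : ℕ → ℝ) (N : ℕ) : Matrix (Fin N) (Fin N) ℝ :=
  fun i j => (if (j : ℕ) = i + 1 then √(ω j) else 0) + (if (i : ℕ) = j + 1 then √(ω i) else 0)

/-- The infinite Jacobi matrix with zero diagonal and off-diagonal entries `√(ω 1), √(ω 2), …`,
acting on all sequences. -/
noncomputable def jacobiOperator (ω x : ℕ → ℝ) : ℕ → ℝ
  | 0 => √(ω 1) * x 1
  | n + 1 => √(ω (n + 2)) * x (n + 2) + √(ω (n + 1)) * x n

/-- The vector of the first `N` entries of a sequence. -/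
def truncate (N : ℕ) (x : ℕ → ℝ) : EuclideanSpace ℝ (Fin N) :=
  WithLp.toLp 2 fun i => x i

theorem norm_truncate_sq (N : ℕ) (x : ℕ → ℝ) :
    ‖truncate N x‖ ^ 2 = ∑ i ∈ Finset.range N, x i ^ 2 := by
  rw [EuclideanSpace.real_norm_sq_eq, ← Fin.sum_univ_eq_sum_range (fun i => x i ^ 2)]
  rfl

theorem inner_truncate_single (N : ℕ) (x : ℕ → ℝ) :
    inner ℝ (truncate (N + 1) x) (truncate (N + 1) (Pi.single 0 1)) = x 0 := by
  simp [truncate, PiLp.inner_apply, Pi.single_apply]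

theorem norm_truncate_single (N : ℕ) : ‖truncate (N + 1) (Pi.single 0 1)‖ = 1 := by
  rw [← sq_eq_sq₀ (norm_nonneg _) zero_le_one, ← real_inner_self_eq_norm_sq, inner_truncate_single]
  simp

theorem isSymmetric_jacobiMatrix (ω : ℕ → ℝ) (N : ℕ) :
    (Matrix.toEuclideanLin (jacobiMatrix ω N)).IsSymmetric := by
  rw [Matrix.isSymmetric_toEuclideanLin_iff]
  ext i j
  simp [jacobiMatrix, add_comm]

theorem jacobiMatrix_truncate (ω : ℕ → ℝ) {N : ℕ} {x : ℕ → ℝ} (hx : x N = 0) :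
    Matrix.toEuclideanLin (jacobiMatrix ω N) (truncate N x) = truncate N (jacobiOperator ω x) := by
  ext ⟨i, hi⟩
  simp only [truncate, Matrix.toLpLin_toLp, Matrix.mulVec, dotProduct, jacobiMatrix,
    Matrix.toLin'_apply]
  rw [Fin.sum_univ_eq_sum_range (fun j => ((if j = i + 1 then √(ω j) else 0) +
    (if i = j + 1 then √(ω i) else 0)) * x j) N]
  simp only [add_mul, Finset.sum_add_distrib, ite_mul, zero_mul, Finset.sum_ite_eq',
    Finset.mem_range]
  have hup : (if i + 1 < N then √(ω (i + 1)) * x (i + 1) else 0) = √(ω (i + 1)) * x (i + 1) := by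
    split_ifs with h
    · rfl
    · rw [show i + 1 = N by omega, hx, mul_zero]
  rw [hup]
  cases i with
  | zero => simp [jacobiOperator]
  | succ i => simp [jacobiOperator, Finset.sum_ite_eq, show i < N by omega]

theorem iterate_jacobiOperator_single_eq_zero (ω : ℕ → ℝ) :
    ∀ {n k : ℕ}, n < k → (jacobiOperator ω)^[n] (Pi.single 0 1) k = 0
  | 0, k, h => Pi.single_eq_of_ne h.ne' _
  | n + 1, k + 1, h => by
    rw [Function.iterate_succ_apply', jacobiOperator,
      iterate_jacobiOperator_single_eq_zero ω (show n < k + 2 by omega),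
      iterate_jacobiOperator_single_eq_zero ω (show n < k by omega)]
    simp

theorem jacobiMatrix_pow_truncate_single (ω : ℕ → ℝ) {N : ℕ} : ∀ {n : ℕ}, n ≤ N →
    (Matrix.toEuclideanLin (jacobiMatrix ω (N + 1)) ^ n) (truncate (N + 1) (Pi.single 0 1)) =
      truncate (N + 1) ((jacobiOperator ω)^[n] (Pi.single 0 1))
  | 0, _ => rfl
  | n + 1, h => by
    rw [pow_succ', Module.End.mul_apply, jacobiMatrix_pow_truncate_single ω (by omega),
      jacobiMatrix_truncate ω (iterate_jacobiOperator_single_eq_zero ω (by omega)),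
      Function.iterate_succ_apply']

variable {ω : ℕ → ℝ}

theorem prod_sqrt_mul_iterate_jacobiOperator_single (hω : ∀ n, 0 ≤ ω (n + 1)) : ∀ n k : ℕ,
    (∏ i ∈ Finset.range k, √(ω (i + 1))) * (jacobiOperator ω)^[n] (Pi.single 0 1) k =
      jacobiMoment ω n k
  | 0, 0 => by simp [jacobiMoment]
  | 0, k + 1 => by simp [jacobiMoment]
  | n + 1, 0 => by
    rw [jacobiMoment, ← prod_sqrt_mul_iterate_jacobiOperator_single hω n 1,
      Function.iterate_succ_apply', jacobiOperator]
    simp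
  | n + 1, k + 1 => by
    rw [jacobiMoment, ← prod_sqrt_mul_iterate_jacobiOperator_single hω n (k + 2),
      ← prod_sqrt_mul_iterate_jacobiOperator_single hω n k, Function.iterate_succ_apply',
      jacobiOperator, Finset.prod_range_succ _ (k + 1), Finset.prod_range_succ _ k]
    linear_combination (∏ i ∈ Finset.range k, √(ω (i + 1))) *
      (jacobiOperator ω)^[n] (Pi.single 0 1) k * Real.mul_self_sqrt (hω k)

variable (ω) in
/-- The spectral measure of the `(N + 1) × (N + 1)` truncated Jacobi matrix at the first basis
vector. Its atoms and weights are the nodes and weights of a Gauss quadrature formula. -/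
noncomputable def quadrature (N : ℕ) : ProbabilityMeasure ℝ :=
  ⟨spectralMeasure (isSymmetric_jacobiMatrix ω (N + 1)) (truncate (N + 1) (Pi.single 0 1)),
    isProbabilityMeasure_spectralMeasure _ _ (norm_truncate_single N)⟩

theorem finiteMoments_quadrature (N : ℕ) : FiniteMoments (quadrature ω N) :=
  fun _ => integrable_spectralMeasure _ _ _

theorem integral_pow_quadrature (hω : ∀ n, 0 ≤ ω (n + 1)) {N n : ℕ} (hn : n ≤ N) :
    ∫ x, x ^ n ∂(quadrature ω N : Measure ℝ) = jacobiMoment ω n 0 := by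
  refine (integral_pow_spectralMeasure _ _ n).trans ?_
  rw [jacobiMatrix_pow_truncate_single ω hn, real_inner_comm, inner_truncate_single,
    ← prod_sqrt_mul_iterate_jacobiOperator_single hω n 0, Finset.prod_range_zero, one_mul]

theorem measureReal_quadrature_ball_le {N : ℕ} {x : ℕ → ℝ} (hx : x (N + 1) = 0)
    (hJ : jacobiOperator ω x = Pi.single 0 1) (ε : ℝ) :
    (quadrature ω N : Measure ℝ).real (Metric.ball 0 ε) ≤
      ε ^ 2 * ∑ i ∈ Finset.range (N + 1), x i ^ 2 := by
  rw [← norm_truncate_sq]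
  refine measureReal_spectralMeasure_ball_le ?_ ε
  rw [jacobiMatrix_truncate ω hx, hJ, zero_smul, zero_add]

theorem sq_le_measureReal_quadrature_singleton {N : ℕ} {x : ℕ → ℝ} (hx : x (N + 1) = 0)
    (hJ : jacobiOperator ω x = 0) :
    x 0 ^ 2 ≤
      (∑ i ∈ Finset.range (N + 1), x i ^ 2) * (quadrature ω N : Measure ℝ).real {0} := by
  rw [← norm_truncate_sq, ← inner_truncate_single N x]
  refine sq_inner_le_measureReal_spectralMeasure_singleton ?_
  rw [jacobiMatrix_truncate ω hx, hJ, zero_smul]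
  rfl

open Filter in
theorem exists_tendsto_quadrature (hω : ∀ n, 0 ≤ ω (n + 1)) {N : ℕ → ℕ}
    (hN : Tendsto N atTop atTop) :
    ∃ (ν : ProbabilityMeasure ℝ) (φ : ℕ → ℕ),
      Tendsto (fun n => quadrature ω (N (φ n))) atTop (nhds ν) ∧ FiniteMoments ν ∧
        ∀ k, ∫ x, x ^ k ∂(ν : Measure ℝ) = jacobiMoment ω k 0 := by
  obtain ⟨ν, φ, -, hν⟩ := exists_tendsto_subseq_of_moments (μ := fun n => quadrature ω (N n))
    (fun n => finiteMoments_quadrature _) fun k =>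
      (hN.eventually_ge_atTop k).mono fun n hn => integral_pow_quadrature hω hn
  exact ⟨ν, φ, hν⟩

end JacobiMatrices

section Symmetrization

/-- The symmetrization of a measure on the real line: the average of the measure and its image under
`x ↦ -x`. -/
noncomputable def symmetrization (ν : Measure ℝ) : Measure ℝ :=
  (2⁻¹ : ENNReal) • (ν + ν.neg)

variable {ν : Measure ℝ}

instance isNegInvariant_symmetrization : (symmetrization ν).IsNegInvariant :=
  ⟨by rw [symmetrization, Measure.neg, Measure.map_smul, Measure.map_add _ _ measurable_neg,
    ← Measure.neg, ← Measure.neg, Measure.neg_neg, add_comm]⟩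

theorem symmetrization_apply_of_neg_eq {s : Set ℝ} (hs : -s = s) :
    symmetrization ν s = ν s := by
  rw [symmetrization, Measure.smul_apply, Measure.add_apply, Measure.neg_apply, hs, smul_eq_mul,
    ← two_mul, ENNReal.inv_mul_cancel_left two_ne_zero ENNReal.ofNat_ne_top]

instance isProbabilityMeasure_symmetrization [IsProbabilityMeasure ν] :
    IsProbabilityMeasure (symmetrization ν) :=
  ⟨(symmetrization_apply_of_neg_eq Set.neg_univ).trans measure_univ⟩

theorem FiniteMoments.neg (h : FiniteMoments ν) : FiniteMoments ν.neg := fun n => by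
  rw [Measure.neg, integrable_map_measure (by fun_prop) (by fun_prop)]
  exact ((h n).const_mul ((-1) ^ n)).congr (.of_forall fun x => (neg_pow x n).symm)

theorem finiteMoments_symmetrization (h : FiniteMoments ν) : FiniteMoments (symmetrization ν) :=
  fun n => ((h n).add_measure (h.neg n)).smul_measure (by simp)

theorem integral_pow_neg (n : ℕ) : ∫ x, x ^ n ∂ν.neg = (-1) ^ n * ∫ x, x ^ n ∂ν := by
  rw [Measure.neg, integral_map (by fun_prop) (by fun_prop), ← integral_const_mul]
  exact integral_congr_ae (.of_forall fun x => neg_pow x n)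

theorem integral_pow_symmetrization (h : FiniteMoments ν)
    (hodd : ∀ n, Odd n → ∫ x, x ^ n ∂ν = 0) (n : ℕ) :
    ∫ x, x ^ n ∂(symmetrization ν) = ∫ x, x ^ n ∂ν := by
  rw [symmetrization, integral_smul_measure, integral_add_measure (h n) (h.neg n),
    integral_pow_neg]
  rcases n.even_or_odd with hn | hn
  · rw [hn.neg_one_pow, ENNReal.toReal_inv, ENNReal.toReal_ofNat, smul_eq_mul]
    ring
  · simp [hodd n hn]

theorem isSymmetricWithJacobi_symmetrization [IsProbabilityMeasure ν] {ω : ℕ → ℝ}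
    (hν : FiniteMoments ν) (hm : ∀ n, ∫ x, x ^ n ∂ν = jacobiMoment ω n 0) :
    IsSymmetricWithJacobi (symmetrization ν) ω where
  isProbabilityMeasure := inferInstance
  isNegInvariant := inferInstance
  hasJacobiSequences :=
    hasJacobiSequences_of_integral_pow (finiteMoments_symmetrization hν) fun n => by
      rw [integral_pow_symmetrization hν (fun k hk => ?_), hm]
      rw [hm, jacobiMoment_eq_zero_of_odd ω k 0 hk]

theorem exists_isSymmetricWithJacobi {ω : ℕ → ℝ} (hω : ∀ n, 0 ≤ ω (n + 1)) :
    ∃ μ, IsSymmetricWithJacobi μ ω :=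
  have ⟨_, _, _, hfin, hm⟩ := exists_tendsto_quadrature hω Filter.tendsto_id
  ⟨_, isSymmetricWithJacobi_symmetrization hfin hm⟩

end Symmetrization

section NonUniqueness

open Filter

variable {ω : ℕ → ℝ}

theorem exists_isSymmetricWithJacobi_singleton_eq_zero (hω : ∀ n, 0 ≤ ω (n + 1)) {x : ℕ → ℝ}
    (hx : ∀ k, x (2 * k) = 0) (hJ : jacobiOperator ω x = Pi.single 0 1)
    (hsum : Summable fun n => x n ^ 2) : ∃ μ, IsSymmetricWithJacobi μ ω ∧ μ {0} = 0 := by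
  obtain ⟨ν, φ, hν, hfin, hm⟩ := exists_tendsto_quadrature hω (N := fun n => 2 * n + 1)
    (tendsto_atTop_mono (fun n => show n ≤ _ by omega) tendsto_id)
  refine ⟨symmetrization ν, isSymmetricWithJacobi_symmetrization hfin hm, ?_⟩
  rw [symmetrization_apply_of_neg_eq (by simp), ← measureReal_eq_zero_iff]
  have hball (ε : ℝ) : (ν : Measure ℝ).real (Metric.ball 0 ε) ≤ ε ^ 2 * ∑' n, x n ^ 2 := by
    refine measureReal_le_of_tendsto_of_isOpen hν Metric.isOpen_ball fun n => ?_
    refine (measureReal_quadrature_ball_le (hx (φ n + 1)) hJ ε).trans ?_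
    gcongr
    exact hsum.sum_le_tsum _ fun i _ => sq_nonneg _
  have hlim : Tendsto (fun ε : ℝ => ε ^ 2 * ∑' n, x n ^ 2) (nhdsWithin 0 (Set.Ioi 0)) (nhds 0) :=
    ((by fun_prop : Continuous fun ε : ℝ => ε ^ 2 * ∑' n, x n ^ 2).tendsto' 0 0
      (by simp)).mono_left nhdsWithin_le_nhds
  refine le_antisymm (ge_of_tendsto hlim ?_) measureReal_nonneg
  filter_upwards [self_mem_nhdsWithin] with ε hε
  exact (measureReal_mono (Set.singleton_subset_iff.2 (Metric.mem_ball_self hε))).trans (hball ε)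

theorem exists_isSymmetricWithJacobi_singleton_ne_zero (hω : ∀ n, 0 ≤ ω (n + 1)) {x : ℕ → ℝ}
    (hx0 : x 0 ≠ 0) (hx : ∀ k, x (2 * k + 1) = 0) (hJ : jacobiOperator ω x = 0)
    (hsum : Summable fun n => x n ^ 2) : ∃ μ, IsSymmetricWithJacobi μ ω ∧ μ {0} ≠ 0 := by
  obtain ⟨ν, φ, hν, hfin, hm⟩ := exists_tendsto_quadrature hω (N := fun n => 2 * n)
    (tendsto_atTop_mono (fun n => show n ≤ _ by omega) tendsto_id)
  refine ⟨symmetrization ν, isSymmetricWithJacobi_symmetrization hfin hm, ?_⟩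
  rw [symmetrization_apply_of_neg_eq (by simp), ← measureReal_ne_zero_iff]
  have hpos : 0 < ∑' n, x n ^ 2 := hsum.tsum_pos (fun n => sq_nonneg _) 0 (by positivity)
  have hatom : x 0 ^ 2 / ∑' n, x n ^ 2 ≤ (ν : Measure ℝ).real {0} := by
    refine le_measureReal_of_tendsto_of_isClosed hν isClosed_singleton fun n => ?_
    rw [div_le_iff₀' hpos]
    refine (sq_le_measureReal_quadrature_singleton (hx (φ n)) hJ).trans ?_
    gcongr
    exact hsum.sum_le_tsum _ fun i _ => sq_nonneg _
  exact ((div_pos (by positivity) hpos).trans_le hatom).ne'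

variable (ω) in
/-- The sequence with initial values `u`, `v` whose image under the Jacobi operator vanishes at all
positive indices. -/
noncomputable def kernelSeq (u v : ℝ) : ℕ → ℝ
  | 0 => u
  | 1 => v
  | n + 2 => -(√(ω (n + 1)) / √(ω (n + 2))) * kernelSeq u v n

theorem jacobiOperator_kernelSeq (hω : ∀ n, 0 < ω (n + 1)) (u v : ℝ) :
    jacobiOperator ω (kernelSeq ω u v) = Pi.single 0 (√(ω 1) * v) := by
  ext (_ | n)
  · rw [jacobiOperator, kernelSeq, Pi.single_eq_same]
  · have := Real.sqrt_ne_zero'.2 (hω (n + 1))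
    rw [jacobiOperator, kernelSeq, Pi.single_eq_of_ne n.succ_ne_zero]
    field_simp
    ring

theorem kernelSeq_two_mul (ω : ℕ → ℝ) (v : ℝ) : ∀ k, kernelSeq ω 0 v (2 * k) = 0
  | 0 => rfl
  | k + 1 => by rw [mul_add, mul_one, kernelSeq, kernelSeq_two_mul ω v k, mul_zero]

theorem kernelSeq_two_mul_add_one (ω : ℕ → ℝ) (u : ℝ) : ∀ k, kernelSeq ω u 0 (2 * k + 1) = 0
  | 0 => rfl
  | k + 1 => by
    rw [mul_add, mul_one, add_right_comm, kernelSeq, kernelSeq_two_mul_add_one ω u k, mul_zero]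

theorem kernelSeq_sq_mul_sqrt_le (hω : ∀ n, 0 < ω (n + 1))
    (hlog : ∀ n, ω (n + 1) * ω (n + 3) ≤ ω (n + 2) ^ 2) (u v : ℝ) :
    ∀ n, kernelSeq ω u v n ^ 2 * √(ω (n + 1)) ≤ u ^ 2 * √(ω 1) + v ^ 2 * √(ω 2)
  | 0 => le_add_of_nonneg_right (by positivity)
  | 1 => le_add_of_nonneg_left (by positivity)
  | n + 2 => by
    have hle : √(ω (n + 1)) * √(ω (n + 3)) ≤ ω (n + 2) := by
      rw [← Real.sqrt_mul (hω n).le]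
      exact Real.sqrt_le_iff.2 ⟨(hω (n + 1)).le, hlog n⟩
    calc kernelSeq ω u v (n + 2) ^ 2 * √(ω (n + 3))
        = kernelSeq ω u v n ^ 2 * √(ω (n + 1)) *
            ((√(ω (n + 1)) * √(ω (n + 3))) / ω (n + 2)) := by
          rw [kernelSeq, mul_pow, neg_sq, div_pow, Real.sq_sqrt (hω (n + 1)).le]
          ring
      _ ≤ kernelSeq ω u v n ^ 2 * √(ω (n + 1)) :=
          mul_le_of_le_one_right (by positivity) ((div_le_one (hω (n + 1))).2 hle)
      _ ≤ _ := kernelSeq_sq_mul_sqrt_le hω hlog u v n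

theorem summable_kernelSeq_sq (hω : ∀ n, 0 < ω (n + 1))
    (hlog : ∀ n, ω (n + 1) * ω (n + 3) ≤ ω (n + 2) ^ 2)
    (hsum : Summable fun n => (√(ω (n + 1)))⁻¹) (u v : ℝ) :
    Summable fun n => kernelSeq ω u v n ^ 2 := by
  refine .of_nonneg_of_le (fun n => sq_nonneg _) (fun n => ?_)
    (hsum.mul_left (u ^ 2 * √(ω 1) + v ^ 2 * √(ω 2)))
  exact (le_mul_inv_iff₀ (Real.sqrt_pos.2 (hω n))).2 (kernelSeq_sq_mul_sqrt_le hω hlog u v n)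

theorem not_existsUnique_isSymmetricWithJacobi (hω : ∀ n, 0 < ω (n + 1))
    (hlog : ∀ n, ω (n + 1) * ω (n + 3) ≤ ω (n + 2) ^ 2)
    (hsum : Summable fun n => (√(ω (n + 1)))⁻¹) : ¬ ∃! μ, IsSymmetricWithJacobi μ ω := by
  obtain ⟨μ, hμ, hμ0⟩ := exists_isSymmetricWithJacobi_singleton_eq_zero (fun n => (hω n).le)
    (kernelSeq_two_mul ω (√(ω 1))⁻¹)
    (by rw [jacobiOperator_kernelSeq hω, mul_inv_cancel₀ (Real.sqrt_ne_zero'.2 (hω 0))])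
    (summable_kernelSeq_sq hω hlog hsum _ _)
  obtain ⟨ν, hν, hν0⟩ := exists_isSymmetricWithJacobi_singleton_ne_zero (fun n => (hω n).le)
    (show kernelSeq ω 1 0 0 ≠ 0 from one_ne_zero) (kernelSeq_two_mul_add_one ω 1)
    (by rw [jacobiOperator_kernelSeq hω, mul_zero, Pi.single_zero])
    (summable_kernelSeq_sq hω hlog hsum _ _)
  exact fun h => hν0 (h.unique hμ hν ▸ hμ0)

end NonUniqueness

section PowerSequences

variable {p : ℝ}

theorem exists_isSymmetricWithJacobi_rpow (p : ℝ) :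
    ∃ μ : Measure ℝ, IsSymmetricWithJacobi μ (fun n : ℕ => (n : ℝ) ^ p) :=
  exists_isSymmetricWithJacobi fun n => by positivity

theorem not_existsUnique_isSymmetricWithJacobi_rpow (hp : 2 < p) :
    ¬ ∃! μ : Measure ℝ, IsSymmetricWithJacobi μ (fun n : ℕ => (n : ℝ) ^ p) := by
  refine not_existsUnique_isSymmetricWithJacobi (fun n => by positivity) (fun n => ?_) ?_
  · rw [← Real.mul_rpow (by positivity) (by positivity), Real.rpow_pow_comm (by positivity)]
    refine Real.rpow_le_rpow (by positivity) ?_ (by linarith)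
    push_cast
    linarith
  · refine ((summable_nat_add_iff 1).2
      (Real.summable_nat_rpow_inv.2 (show 1 < p / 2 by linarith))).congr fun n => ?_
    rw [Real.sqrt_eq_rpow, ← Real.rpow_mul (by positivity), mul_one_div]

theorem IsSymmetricWithJacobi.isMomentDeterminate_rpow_iff {μ : Measure ℝ}
    (hμ : IsSymmetricWithJacobi μ (fun n : ℕ => (n : ℝ) ^ p)) :
    IsMomentDeterminate μ ↔ p ≤ 2 := by
  refine ⟨fun h => ?_, fun hp => hμ.isMomentDeterminate zero_le_one (fun k => by positivity)
    fun k => ?_⟩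
  · by_contra! hp
    exact not_existsUnique_isSymmetricWithJacobi_rpow hp (hμ.existsUnique h)
  · rw [one_mul, ← Nat.cast_add_one, ← Real.rpow_two]
    exact Real.rpow_le_rpow_of_exponent_le (by simp) hp

theorem existsUnique_isSymmetricWithJacobi_rpow_iff :
    (∃! μ : Measure ℝ, IsSymmetricWithJacobi μ (fun n : ℕ => (n : ℝ) ^ p)) ↔ p ≤ 2 := by
  refine ⟨fun h => ?_, fun hp => ?_⟩
  · by_contra! hp
    exact not_existsUnique_isSymmetricWithJacobi_rpow hp h
  · obtain ⟨μ, hμ⟩ := exists_isSymmetricWithJacobi_rpow p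
    exact hμ.existsUnique (hμ.isMomentDeterminate_rpow_iff.2 hp)

end PowerSequences

section HyperbolicSecant

open ProbabilityTheory Filter Set
open scoped Topology Nat

theorem sigmoid_rpow_mul_sigmoid_neg_rpow (x a b : ℝ) :
    Real.sigmoid x ^ a * Real.sigmoid (-x) ^ b =
      Real.exp ((a - b) * (x / 2)) / (Real.exp (x / 2) + Real.exp (-(x / 2))) ^ (a + b) := by
  have sigmoid_eq (y : ℝ) :
      Real.sigmoid y = Real.exp (y / 2) / (Real.exp (y / 2) + Real.exp (-(y / 2))) := by
    have hexp : Real.exp (-y) = Real.exp (-(y / 2)) / Real.exp (y / 2) := by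
      rw [← Real.exp_sub]
      ring_nf
    rw [Real.sigmoid_def, hexp]
    field_simp
  rw [sigmoid_eq, sigmoid_eq, neg_div, neg_neg, add_comm (Real.exp (-(x / 2))),
    Real.div_rpow (by positivity) (by positivity), Real.div_rpow (by positivity) (by positivity),
    div_mul_div_comm, ← Real.rpow_add (by positivity), ← Real.exp_mul, ← Real.exp_mul,
    ← Real.exp_add]
  ring_nf

theorem lintegral_sigmoid_rpow_mul_sigmoid_neg_rpow {a b c : ℝ} (ha : 0 < a) (hb : 0 < b)
    (hc : 0 < c) :
    ∫⁻ x, ENNReal.ofReal (Real.sigmoid (c * x) ^ a * Real.sigmoid (-(c * x)) ^ b) =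
      ENNReal.ofReal (beta a b / c) := by
  have hbeta := beta_pos ha hb
  have hderiv (x : ℝ) : HasDerivWithinAt (fun x => Real.sigmoid (c * x))
      (c * (Real.sigmoid (c * x) * Real.sigmoid (-(c * x)))) univ x := by
    rw [Real.sigmoid_neg, mul_comm c (_ * _)]
    simpa only [mul_one, Function.comp_def] using
      ((Real.hasDerivAt_sigmoid _).comp x ((hasDerivAt_id' x).const_mul c)).hasDerivWithinAt
  have hinj : InjOn (fun x => Real.sigmoid (c * x)) univ :=
    (Real.sigmoid_injective.comp (mul_right_injective₀ hc.ne')).injOn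
  have himage : (fun x => Real.sigmoid (c * x)) '' univ = Ioo 0 1 := by
    rw [image_univ, ← Real.range_sigmoid]
    exact (mul_left_surjective₀ hc.ne').range_comp Real.sigmoid
  have hone := lintegral_betaPDF_eq_one ha hb
  rw [lintegral_betaPDF, ← himage, lintegral_image_eq_lintegral_abs_deriv_mul .univ
    (fun x _ => hderiv x) hinj, Measure.restrict_univ] at hone
  rw [← mul_one (ENNReal.ofReal (beta a b / c)), ← hone,
    ← lintegral_const_mul' _ _ ENNReal.ofReal_ne_top]
  refine lintegral_congr fun x => ?_
  have hσ := Real.sigmoid_pos (c * x)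
  have hσ' := Real.sigmoid_pos (-(c * x))
  rw [← Real.sigmoid_neg, abs_of_pos (by positivity), ← ENNReal.ofReal_mul (by positivity),
    ← ENNReal.ofReal_mul (by positivity), Real.rpow_sub_one hσ.ne', Real.rpow_sub_one hσ'.ne']
  field_simp

theorem lintegral_exp_mul_hyperbolicSecant {s : ℝ} (hs : |s| < Real.pi / 2) :
    ∫⁻ x, ENNReal.ofReal (Real.exp (s * x)) ∂hyperbolicSecant =
      ENNReal.ofReal (1 / Real.cos s) := by
  have hpi := Real.pi_pos
  have hs' : |s / Real.pi| < 1 / 2 := by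
    rw [abs_div, abs_of_pos hpi, div_lt_iff₀ hpi]
    linarith
  obtain ⟨hneg, hpos⟩ := abs_lt.1 hs'
  have hbeta : beta (1 / 2 + s / Real.pi) (1 - (1 / 2 + s / Real.pi)) / Real.pi =
      1 / Real.cos s := by
    rw [beta, Real.Gamma_mul_Gamma_one_sub, add_sub_cancel, Real.Gamma_one,
      ← Real.sin_add_pi_div_two, show Real.pi * (1 / 2 + s / Real.pi) = s + Real.pi / 2 by
        field_simp; ring]
    field_simp
  rw [← hbeta, ← lintegral_sigmoid_rpow_mul_sigmoid_neg_rpow (by linarith) (by linarith) hpi,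
    hyperbolicSecant, lintegral_withDensity_eq_lintegral_mul _ (by fun_prop) (by fun_prop)]
  refine lintegral_congr fun x => ?_
  rw [Pi.mul_apply, ← ENNReal.ofReal_mul (by positivity), sigmoid_rpow_mul_sigmoid_neg_rpow,
    add_sub_cancel, Real.rpow_one, one_div_mul_eq_div]
  congr 3
  field_simp
  ring

theorem isProbabilityMeasure_hyperbolicSecant : IsProbabilityMeasure hyperbolicSecant :=
  ⟨by simpa using lintegral_exp_mul_hyperbolicSecant (s := 0) (by simpa using Real.pi_pos)⟩

theorem mgf_id_hyperbolicSecant {s : ℝ} (hs : |s| < Real.pi / 2) :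
    mgf id hyperbolicSecant s = 1 / Real.cos s := by
  have hcos : 0 < Real.cos s := Real.cos_pos_of_mem_Ioo (abs_lt.1 hs)
  simp only [mgf, id]
  rw [integral_eq_lintegral_of_nonneg_ae (.of_forall fun x => (Real.exp_pos _).le) (by fun_prop),
    lintegral_exp_mul_hyperbolicSecant hs, ENNReal.toReal_ofReal (by positivity)]

theorem zero_mem_interior_integrableExpSet_hyperbolicSecant :
    0 ∈ interior (integrableExpSet id hyperbolicSecant) := by
  refine mem_interior.2 ⟨Ioo (-(Real.pi / 2)) (Real.pi / 2), fun s hs => ⟨by fun_prop, ?_⟩,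
    isOpen_Ioo, by simp [Real.pi_pos]⟩
  rw [hasFiniteIntegral_iff_ofReal (.of_forall fun x => (Real.exp_pos _).le)]
  simp only [id]
  rw [lintegral_exp_mul_hyperbolicSecant (abs_lt.2 hs)]
  exact ENNReal.ofReal_lt_top

theorem isNegInvariant_withDensity {G : Type*} [MeasurableSpace G] [InvolutiveNeg G]
    [MeasurableNeg G] {μ : Measure G} [μ.IsNegInvariant] {f : G → ENNReal}
    (hf : Function.Even f) : (μ.withDensity f).IsNegInvariant := by
  refine ⟨Measure.ext fun t ht => ?_⟩
  rw [Measure.neg, Measure.map_apply measurable_neg ht, withDensity_apply _ ht,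
    withDensity_apply _ (measurable_neg ht),
    ← (Measure.measurePreserving_neg μ).setLIntegral_comp_preimage_emb
      (MeasurableEquiv.neg G).measurableEmbedding]
  simp only [hf _, neg_preimage, neg_neg]

theorem isNegInvariant_hyperbolicSecant : hyperbolicSecant.IsNegInvariant :=
  isNegInvariant_withDensity fun x => by simp only [mul_neg, neg_div, neg_neg, add_comm]

theorem iteratedDeriv_eq_jacobiMoment {𝕜 : Type*} [NontriviallyNormedField 𝕜] {ω : ℕ → 𝕜}
    {G : ℕ → 𝕜 → 𝕜} {x : 𝕜} (hG : ∀ (k n : ℕ), ContDiffAt 𝕜 n (G k) x)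
    (hderiv_zero : deriv (G 0) =ᶠ[𝓝 x] G 1)
    (hderiv_succ : ∀ k, deriv (G (k + 1)) =ᶠ[𝓝 x] fun t => G (k + 2) t + ω (k + 1) * G k t)
    (hx : ∀ k, G k x = jacobiMoment ω 0 k) (n k : ℕ) :
    iteratedDeriv n (G k) x = jacobiMoment ω n k := by
  induction n generalizing k with
  | zero => rw [iteratedDeriv_zero, hx]
  | succ n ih =>
    rw [iteratedDeriv_succ']
    cases k with
    | zero => rw [hderiv_zero.iteratedDeriv_eq, ih, jacobiMoment]
    | succ k =>
      rw [(hderiv_succ k).iteratedDeriv_eq,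
        iteratedDeriv_fun_add (hG (k + 2) n) (contDiffAt_const.mul (hG k n)),
        iteratedDeriv_const_mul_field, ih, ih, jacobiMoment]

/-- At `k = 0` the last summand vanishes, so the truncation of `k - 1` is harmless. -/
theorem hasDerivAt_factorial_mul_tan_pow_div_cos {s : ℝ} (hs : Real.cos s ≠ 0) (k : ℕ) :
    HasDerivAt (fun s => k ! * Real.tan s ^ k / Real.cos s)
      ((k + 1)! * Real.tan s ^ (k + 1) / Real.cos s +
        (k : ℝ) ^ 2 * ((k - 1)! * Real.tan s ^ (k - 1) / Real.cos s)) s := by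
  have hsec : 1 / Real.cos s ^ 2 = 1 + Real.tan s ^ 2 := by
    rw [← Real.inv_one_add_tan_sq hs, one_div, inv_inv]
  have h := (((Real.hasDerivAt_tan hs).pow k).const_mul (k ! : ℝ)).div (Real.hasDerivAt_cos s) hs
  rw [hsec, ← Real.tan_mul_cos hs] at h
  convert! h using 1
  rcases k with _ | k <;>
    simp only [Nat.factorial_succ, Nat.factorial_zero, Nat.add_sub_cancel, Pi.pow_apply] <;>
    push_cast <;> field_simp <;> ring

theorem integral_pow_hyperbolicSecant (n : ℕ) :
    ∫ x, x ^ n ∂hyperbolicSecant = jacobiMoment (fun n => (n : ℝ) ^ 2) n 0 := by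
  have hcos : ∀ᶠ s in 𝓝 (0 : ℝ), Real.cos s ≠ 0 :=
    Real.continuous_cos.continuousAt.eventually_ne (by simp)
  have hmgf : mgf id hyperbolicSecant =ᶠ[𝓝 0] fun s => 0 ! * Real.tan s ^ 0 / Real.cos s := by
    filter_upwards [continuous_abs.continuousAt.eventually_lt_const
      (by simp [Real.pi_pos] : |(0 : ℝ)| < Real.pi / 2)] with s hs
    simpa using mgf_id_hyperbolicSecant hs
  rw [← iteratedDeriv_eq_jacobiMoment (G := fun k s => k ! * Real.tan s ^ k / Real.cos s) (x := 0),
    ← hmgf.iteratedDeriv_eq,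
    iteratedDeriv_mgf_zero zero_mem_interior_integrableExpSet_hyperbolicSecant]
  · rfl
  · exact fun k n => (contDiffAt_const.mul ((Real.contDiffAt_tan.2 (by simp)).pow k)).div
      Real.contDiff_cos.contDiffAt (by simp)
  · filter_upwards [hcos] with s hs
    simpa using (hasDerivAt_factorial_mul_tan_pow_div_cos hs 0).deriv
  · intro k
    filter_upwards [hcos] with s hs
    exact (hasDerivAt_factorial_mul_tan_pow_div_cos hs (k + 1)).deriv
  · rintro (_ | k) <;> simp [jacobiMoment]

theorem isSymmetricWithJacobi_hyperbolicSecant :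
    IsSymmetricWithJacobi hyperbolicSecant (fun n : ℕ => (n : ℝ) ^ 2) where
  isProbabilityMeasure := isProbabilityMeasure_hyperbolicSecant
  isNegInvariant := isNegInvariant_hyperbolicSecant
  hasJacobiSequences := hasJacobiSequences_of_integral_pow
    (integrable_pow_of_mem_interior_integrableExpSet
      zero_mem_interior_integrableExpSet_hyperbolicSecant) integral_pow_hyperbolicSecant

end HyperbolicSecant

theorem mainTheorem3_general :
    (∀ p : ℝ,
      (∃ μ : Measure ℝ, IsSymmetricWithJacobi μ (fun n : ℕ => (n : ℝ) ^ p)) ∧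
      (∀ μ : Measure ℝ, IsSymmetricWithJacobi μ (fun n : ℕ => (n : ℝ) ^ p) →
        (IsMomentDeterminate μ ↔ p ≤ 2)) ∧
      ((∃! μ : Measure ℝ, IsSymmetricWithJacobi μ (fun n : ℕ => (n : ℝ) ^ p)) ↔ p ≤ 2)) ∧
    IsSymmetricWithJacobi hyperbolicSecant (fun n : ℕ => (n : ℝ) ^ (2 : ℝ)) ∧
    IsMomentDeterminate hyperbolicSecant := by
  have hsech : IsSymmetricWithJacobi hyperbolicSecant (fun n : ℕ => (n : ℝ) ^ (2 : ℝ)) := by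
    simpa only [Real.rpow_two] using isSymmetricWithJacobi_hyperbolicSecant
  exact ⟨fun p => ⟨exists_isSymmetricWithJacobi_rpow p, fun μ hμ => hμ.isMomentDeterminate_rpow_iff,
    existsUnique_isSymmetricWithJacobi_rpow_iff⟩, hsech,
    hsech.isMomentDeterminate_rpow_iff.2 le_rfl⟩

theorem mainTheorem3 :
    (∀ p : ℝ, 0 < p →
      (∃ μ : Measure ℝ, IsSymmetricWithJacobi μ (fun n : ℕ => (n : ℝ) ^ p)) ∧
      (∀ μ : Measure ℝ, IsSymmetricWithJacobi μ (fun n : ℕ => (n : ℝ) ^ p) →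
        (IsMomentDeterminate μ ↔ p ≤ 2)) ∧
      ((∃! μ : Measure ℝ, IsSymmetricWithJacobi μ (fun n : ℕ => (n : ℝ) ^ p)) ↔ p ≤ 2)) ∧
    IsSymmetricWithJacobi hyperbolicSecant (fun n : ℕ => (n : ℝ) ^ (2 : ℝ)) ∧
    IsMomentDeterminate hyperbolicSecant :=
  ⟨fun p _ => mainTheorem3_general.1 p, mainTheorem3_general.2⟩
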